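/- Let $R$ be a commutative ring with unit. $R$ is a chain ring if its ideals are totally ordered by inclusion, and arithmetical if $R_P$ is a chain ring for every maximal ideal $P$. $R$ is IF if every injective $R$-module is flat, and semicoherent if for all injective $R$-modules $E, F$ the $R$-module $\mathrm{Hom}_R(E,F)$ is isomorphic to a submodule of a flat $R$-module. $R$ is locally IF (respectively locally semicoherent) if $R_P$ is IF (respectively semicoherent) for every maximal ideal $P$ of $R$. The weak dimension $\mathrm{w.d.}(M)$ of an $R$-module $M$ is the least integer $n \ge 0$ such that $\mathrm{Tor}^R_{n+1}(M,N)=0$ for every $R$-module $N$, or $\infty$ if there is no such $n$. The finitistic weak dimension $\mathrm{f.w.d.}(R)$ is the supremum of $\mathrm{w.d.}(M)$ over all $R$-modules $M$ with $\mathrm{w.d.}(M)<\infty$. **Theorem.** Let $R$ be an arithmetical ring. Then: 1. $\mathrm{f.w.d.}(R)=0$ if $R$ is locally IF; 2. $\mathrm{f.w.d.}(R)=1$ if $R$ is locally semicoherent and not locally IF; 3. $\mathrm{f.w.d.}(R)=2$ if $R$ is not locally semicoherent. In particular, $\mathrm{f.w.d.}(R)\le 2$ always. -/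

import Mathlib

open CategoryTheory

universe u

/-- A chain ring: the lattice of ideals is totally ordered by inclusion. -/
def IsChainRing (R : Type u) [CommRing R] : Prop :=
  ∀ I J : Ideal R, I ≤ J ∨ J ≤ I

/-- An arithmetical ring: every localization at a maximal ideal is a chain ring. -/
def IsArithmeticalRing (R : Type u) [CommRing R] : Prop :=
  ∀ (P : Ideal R) [P.IsMaximal], IsChainRing (Localization.AtPrime P)

/-- An IF ring: every injective module is flat. -/
def IsIFRing (R : Type u) [CommRing R] : Prop :=
  ∀ (E : Type u) [AddCommGroup E] [Module R E], Module.Injective R E → Module.Flat R E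

/-- A semicoherent ring: for all injective modules `E` and `F`, the module `Hom_R(E, F)` embeds
into a flat module. -/
def IsSemicoherentRing (R : Type u) [CommRing R] : Prop :=
  ∀ (E F : Type u) [AddCommGroup E] [Module R E] [AddCommGroup F] [Module R F],
    Module.Injective R E → Module.Injective R F →
      ∃ (G : Type u) (_ : AddCommGroup G) (_ : Module R G) (φ : (E →ₗ[R] F) →ₗ[R] G),
        Module.Flat R G ∧ Function.Injective φ

/-- Every localization at a maximal ideal is an IF ring. -/
def IsLocallyIF (R : Type u) [CommRing R] : Prop :=
  ∀ (P : Ideal R) [P.IsMaximal], IsIFRing (Localization.AtPrime P)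

/-- Every localization at a maximal ideal is semicoherent. -/
def IsLocallySemicoherent (R : Type u) [CommRing R] : Prop :=
  ∀ (P : Ideal R) [P.IsMaximal], IsSemicoherentRing (Localization.AtPrime P)

/-- `w.d.(M) ≤ n`: `Tor_{n+1}(M, N) = 0` for every module `N`. -/
def HasWeakDimensionLE {R : Type u} [CommRing R] (M : ModuleCat.{u} R) (n : ℕ) : Prop :=
  ∀ N : ModuleCat.{u} R, Limits.IsZero (((Tor (ModuleCat.{u} R) (n + 1)).obj M).obj N)

/-- The weak dimension of a module: the least `n` with `w.d.(M) ≤ n`, and `⊤` if there is none. -/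
noncomputable def weakDimension {R : Type u} [CommRing R] (M : ModuleCat.{u} R) : ℕ∞ :=
  ⨅ (n : ℕ) (_ : HasWeakDimensionLE M n), (n : ℕ∞)

/-- The finitistic weak dimension of a ring: the supremum of the weak dimensions of the modules of
finite weak dimension. -/
noncomputable def finitisticWeakDimension (R : Type u) [CommRing R] : ℕ∞ :=
  ⨆ (M : ModuleCat.{u} R) (_ : weakDimension M < ⊤), weakDimension M

/-!
The weak dimension of a module `M` is computed by flat syzygies: `w.d.(M) ≤ 0` means that `M` is
flat, and `w.d.(M) ≤ n + 1` means `w.d.(K) ≤ n` for any exact sequence `0 → K → F → M → 0` with `F`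
flat (`weakDimLE_zero_iff`, `FlatPresentation.weakDimLE_succ_iff`). Flatness is a local property and
does not change between a localization and its base ring, so everything reduces to a chain ring
`R = R_P`. Also, if `w.d.(M) ≤ n + 1`, then `Tor_{n+1}(M, -)` is left exact and it suffices to see
that it vanishes on injective modules; hence a bound on the weak dimensions of the injective modules
bounds all finite weak dimensions (`WeakDimLE.of_injective_le`). This settles the case of IF rings.

Let `Q` be the total ring of fractions of the chain ring `R`. Syzygies are torsion-free, and a
torsion-free `R`-module is flat as soon as its localization over `Q` is; therefore
`w.d._R(M) ≤ max(1, w.d._Q(M_Q))` (`weakDimLE_succ_of_localizedModule`). Moreover `R` is semicoherent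
if and only if `Q` is IF (`IsSemicoherentRing.isIFRing`, `isSemicoherentRing_of_isIFRing`), which
gives the bound `1` for semicoherent rings. It is attained by `R / aR` for a regular nonunit `a`,
which exists unless `R = Q`.

If `Q` is not IF, then no nonzero nonunit of `Q` has a principal annihilator
(`not_hasPrincipalAnnihilator`), while `(0 : (0 : a)) = (a)` for all `a`
(`dvd_of_forall_mul_eq_zero`). Over a chain ring, flatness and `w.d. ≤ 1` can be expressed by
elements (`flat_of_forall_exists_eq_smul`, `weakDimLE_one_of_forall`). With these criteria one finds
that every injective `Q`-module has weak dimension at most `2`, and that an injective module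
containing `Q / cQ`, for a nonzero nonunit `c`, does not have weak dimension at most `1`
(`weakDimLE_two_of_injective`, `exists_injective_not_weakDimLE_one`).
-/

/-! ### Flat presentations and the balance of `Tor₁` -/

open TensorProduct in
lemma rTensor_lTensor_apply {R : Type u} [CommRing R] {A B C D : Type u}
    [AddCommGroup A] [Module R A] [AddCommGroup B] [Module R B] [AddCommGroup C] [Module R C]
    [AddCommGroup D] [Module R D] (f : A →ₗ[R] B) (g : C →ₗ[R] D) (t : A ⊗[R] C) :
    f.rTensor D (g.lTensor A t) = g.lTensor B (f.rTensor C t) := by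
  rw [← LinearMap.comp_apply, ← LinearMap.comp_apply, LinearMap.rTensor_comp_lTensor,
    LinearMap.lTensor_comp_rTensor]

/-- A short exact sequence `0 → K → F → M → 0` of modules with `F` flat. -/
structure FlatPresentation {R : Type u} [CommRing R] {K F M : Type u}
    [AddCommGroup K] [Module R K] [AddCommGroup F] [Module R F] [AddCommGroup M] [Module R M]
    (i : K →ₗ[R] F) (p : F →ₗ[R] M) : Prop where
  flat : Module.Flat R F
  inj : Function.Injective i
  exact : Function.Exact i p
  surj : Function.Surjective p

section

variable {R : Type u} [CommRing R] {K F M L P X : Type u}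
  [AddCommGroup K] [Module R K] [AddCommGroup F] [Module R F] [AddCommGroup M] [Module R M]
  [AddCommGroup L] [Module R L] [AddCommGroup P] [Module R P] [AddCommGroup X] [Module R X]

lemma flatPresentation_subtype_ker [Module.Flat R F] {p : F →ₗ[R] M}
    (hp : Function.Surjective p) : FlatPresentation (LinearMap.ker p).subtype p :=
  ⟨inferInstance, Subtype.val_injective, LinearMap.exact_subtype_ker_map p, hp⟩

lemma exists_flatPresentation (R : Type u) [CommRing R] (M : Type u) [AddCommGroup M]
    [Module R M] : ∃ (K F : Type u) (_ : AddCommGroup K) (_ : Module R K) (_ : AddCommGroup F)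
      (_ : Module R F) (i : K →ₗ[R] F) (p : F →ₗ[R] M), FlatPresentation i p :=
  ⟨_, M →₀ R, inferInstance, inferInstance, inferInstance, inferInstance, _, _,
    flatPresentation_subtype_ker (Finsupp.linearCombination_id_surjective R M)⟩

/-- Chase in the diagram with rows `K ⊗ - → F ⊗ - → M ⊗ -` and columns `- ⊗ L → - ⊗ P → - ⊗ X`; only
the flatness of `F` is used. -/
lemma lTensor_injective_of_rTensor_injective {i : K →ₗ[R] F} {p : F →ₗ[R] M}
    (h : FlatPresentation i p) {j : L →ₗ[R] P} {q : P →ₗ[R] X} (hjq : Function.Exact j q)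
    (hj : Function.Injective j) (hq : Function.Surjective q)
    (hi : Function.Injective (i.rTensor X)) : Function.Injective (j.lTensor M) := by
  have := h.flat
  rw [injective_iff_map_eq_zero]
  intro t ht
  obtain ⟨t', rfl⟩ := LinearMap.rTensor_surjective L h.surj t
  rw [← rTensor_lTensor_apply] at ht
  obtain ⟨s, hs⟩ := (rTensor_exact P h.exact h.surj _).1 ht
  have h1 : q.lTensor K s = 0 := by
    apply hi
    rw [rTensor_lTensor_apply, hs, map_zero]
    exact (lTensor_exact F hjq hq).apply_apply_eq_zero t'
  obtain ⟨w, rfl⟩ := (lTensor_exact K hjq hq _).1 h1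
  rw [rTensor_lTensor_apply] at hs
  rw [← Module.Flat.lTensor_preserves_injective_linearMap (M := F) j hj hs]
  exact (rTensor_exact L h.exact h.surj).apply_apply_eq_zero w

/-- `Tor₁` is balanced: it may be computed by a flat presentation of either variable. -/
lemma lTensor_injective_iff_rTensor_injective {i : K →ₗ[R] F} {p : F →ₗ[R] M}
    (h : FlatPresentation i p) {j : L →ₗ[R] P} {q : P →ₗ[R] X} (h' : FlatPresentation j q) :
    Function.Injective (j.lTensor M) ↔ Function.Injective (i.rTensor X) := by
  refine ⟨fun H ↦ ?_, lTensor_injective_of_rTensor_injective h h'.exact h'.inj h'.surj⟩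
  rw [← LinearMap.lTensor_inj_iff_rTensor_inj]
  rw [LinearMap.lTensor_inj_iff_rTensor_inj] at H
  exact lTensor_injective_of_rTensor_injective h' h.exact h.inj h.surj H

/-- Both conditions say that `K ⊗ L → F ⊗ P` is injective. For syzygies `K` of `M` and `L` of `X`,
this is the isomorphism `Tor₁(K, X) ≅ Tor₁(M, L)`, both being `Tor₂(M, X)`. -/
lemma lTensor_injective_iff_rTensor_injective_of_flat [Module.Flat R F] [Module.Flat R P]
    {i : K →ₗ[R] F} (hi : Function.Injective i) {j : L →ₗ[R] P} (hj : Function.Injective j) :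
    Function.Injective (j.lTensor K) ↔ Function.Injective (i.rTensor L) := by
  have h1 := Module.Flat.rTensor_preserves_injective_linearMap (M := P) i hi
  have h2 := Module.Flat.lTensor_preserves_injective_linearMap (M := F) j hj
  have h3 : i.rTensor P ∘ j.lTensor K = j.lTensor F ∘ i.rTensor L :=
    funext fun t ↦ rTensor_lTensor_apply i j t
  rw [← h1.of_comp_iff, h3, h2.of_comp_iff]

/-- Homology of `M ⊗ K → M ⊗ F → M ⊗ P` is the kernel of `M ⊗ range g → M ⊗ P`. -/
lemma exact_lTensor_iff {f : K →ₗ[R] F} {g : F →ₗ[R] P} (h : Function.Exact f g) :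
    Function.Exact (f.lTensor M) (g.lTensor M) ↔
      Function.Injective ((LinearMap.range g).subtype.lTensor M) := by
  have hs : Function.Surjective g.rangeRestrict := LinearMap.surjective_rangeRestrict g
  have he : Function.Exact f g.rangeRestrict := fun x ↦ by
    rw [← h x, Subtype.ext_iff]; rfl
  have ht := lTensor_exact M he hs
  have hc : ∀ t, g.lTensor M t =
      (LinearMap.range g).subtype.lTensor M (g.rangeRestrict.lTensor M t) := fun t ↦ by
    rw [← LinearMap.lTensor_comp_apply]; rfl
  constructor
  · intro H
    rw [injective_iff_map_eq_zero]
    intro t h0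
    obtain ⟨t, rfl⟩ := LinearMap.lTensor_surjective M hs t
    rw [← hc] at h0
    exact (ht t).2 ((H t).1 h0)
  · intro H t
    rw [hc, map_eq_zero_iff _ H]
    exact ht t

end

/-! ### Vanishing of `Tor` and dimension shifting -/

/-- `Tor_{n+1}(M, X) = 0`, for unbundled modules. -/
def TorSuccVanishes (R : Type u) [CommRing R] (n : ℕ) (M X : Type u)
    [AddCommGroup M] [Module R M] [AddCommGroup X] [Module R X] : Prop :=
  Limits.IsZero (((Tor (ModuleCat.{u} R) (n + 1)).obj (ModuleCat.of R M)).obj (ModuleCat.of R X))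

section

variable {R : Type u} [CommRing R] {K F M L P X : Type u}
  [AddCommGroup K] [Module R K] [AddCommGroup F] [Module R F] [AddCommGroup M] [Module R M]
  [AddCommGroup L] [Module R L] [AddCommGroup P] [Module R P] [AddCommGroup X] [Module R X]

lemma torSuccVanishes_iff_exact (n : ℕ) (Q : ProjectiveResolution (ModuleCat.of R X)) :
    TorSuccVanishes R n M X ↔ Function.Exact ((Q.complex.d (n + 2) (n + 1)).hom.lTensor M)
      ((Q.complex.d (n + 1) n).hom.lTensor M) := by
  let T := (MonoidalCategory.tensoringLeft (ModuleCat.{u} R)).obj (ModuleCat.of R M)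
  change Limits.IsZero ((T.leftDerived (n + 1)).obj (ModuleCat.of R X)) ↔ _
  rw [(Q.isoLeftDerivedObj T (n + 1)).isZero_iff]
  change Limits.IsZero (HomologicalComplex.homology _ (n + 1)) ↔ _
  rw [← HomologicalComplex.exactAt_iff_isZero_homology,
    HomologicalComplex.exactAt_iff' _ (n + 2) (n + 1) n (by simp) (by simp),
    ShortComplex.ShortExact.moduleCat_exact_iff_function_exact]
  rfl

/-- `Tor_{n+1}(M, X)` is the kernel of `M ⊗ Ωⁿ⁺¹ → M ⊗ Q_n`, where `Ωⁿ⁺¹ ⊆ Q_n` is the syzygy in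
a projective resolution `Q` of `X`. -/
lemma torSuccVanishes_iff_injective (n : ℕ) (Q : ProjectiveResolution (ModuleCat.of R X)) :
    TorSuccVanishes R n M X ↔
      Function.Injective ((LinearMap.range (Q.complex.d (n + 1) n).hom).subtype.lTensor M) := by
  rw [torSuccVanishes_iff_exact n Q]
  exact exact_lTensor_iff
    ((ShortComplex.ShortExact.moduleCat_exact_iff_function_exact _).1 (Q.exact_succ n))

lemma flat_of_projectiveResolution (Q : ProjectiveResolution (ModuleCat.of R X)) (n : ℕ) :
    Module.Flat R (Q.complex.X n) := by
  have := (IsProjective.iff_projective (Q.complex.X n)).2 (Q.projective n)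
  infer_instance

lemma flatPresentation_zero (Q : ProjectiveResolution (ModuleCat.of R X)) :
    FlatPresentation (LinearMap.range (Q.complex.d 1 0).hom).subtype
      (M := X) (Q.π.f 0).hom := by
  have he : (ShortComplex.mk _ _ Q.complex_d_comp_π_f_zero).Exact :=
    ShortComplex.exact_of_g_is_cokernel _ Q.isColimitCokernelCofork
  rw [ShortComplex.ShortExact.moduleCat_exact_iff_function_exact] at he
  refine ⟨flat_of_projectiveResolution Q 0, Subtype.val_injective, fun x ↦ ?_,
    (ModuleCat.epi_iff_surjective (Q.π.f 0)).1 inferInstance⟩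
  refine (he x).trans ?_
  simp

/-- The syzygies of `X` in a projective resolution are presented by its terms. -/
lemma flatPresentation_succ (Q : ProjectiveResolution (ModuleCat.of R X)) (n : ℕ) :
    FlatPresentation (LinearMap.range (Q.complex.d (n + 2) (n + 1)).hom).subtype
      (Q.complex.d (n + 1) n).hom.rangeRestrict := by
  have := flat_of_projectiveResolution Q (n + 1)
  have he := (ShortComplex.ShortExact.moduleCat_exact_iff_function_exact _).1 (Q.exact_succ n)
  refine ⟨this, Subtype.val_injective, fun x ↦ ?_, LinearMap.surjective_rangeRestrict _⟩
  rw [Subtype.ext_iff]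
  refine (he x).trans ?_
  simp

/-- `Tor₁(M, X)` from a flat presentation of `X`. -/
lemma torSuccVanishes_zero_iff_lTensor {j : L →ₗ[R] P} {q : P →ₗ[R] X}
    (h' : FlatPresentation j q) :
    TorSuccVanishes R 0 M X ↔ Function.Injective (j.lTensor M) := by
  obtain ⟨K, F, _, _, _, _, i, p, h⟩ := exists_flatPresentation R M
  rw [torSuccVanishes_iff_injective 0 (projectiveResolution _),
    lTensor_injective_iff_rTensor_injective h (flatPresentation_zero _),
    lTensor_injective_iff_rTensor_injective h h']
  exact Iff.rfl

/-- `Tor₁(M, X)` from a flat presentation of `M`. -/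
lemma torSuccVanishes_zero_iff_rTensor {i : K →ₗ[R] F} {p : F →ₗ[R] M}
    (h : FlatPresentation i p) :
    TorSuccVanishes R 0 M X ↔ Function.Injective (i.rTensor X) := by
  obtain ⟨_, _, _, _, _, _, _, _, h'⟩ := exists_flatPresentation R X
  rw [torSuccVanishes_zero_iff_lTensor h', lTensor_injective_iff_rTensor_injective h h']

/-- Dimension shifting in the first variable. -/
lemma torSuccVanishes_succ_iff {i : K →ₗ[R] F} {p : F →ₗ[R] M}
    (h : FlatPresentation i p) (n : ℕ) :
    TorSuccVanishes R (n + 1) M X ↔ TorSuccVanishes R n K X := by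
  let Q := projectiveResolution (ModuleCat.of R X)
  have := h.flat
  have := flat_of_projectiveResolution Q n
  rw [torSuccVanishes_iff_injective (n + 1) Q, torSuccVanishes_iff_injective n Q,
    lTensor_injective_iff_rTensor_injective h (flatPresentation_succ Q n),
    lTensor_injective_iff_rTensor_injective_of_flat h.inj Subtype.val_injective]

/-- Dimension shifting in the second variable. -/
lemma torSuccVanishes_succ_iff' {j : L →ₗ[R] P} {q : P →ₗ[R] X} (h : FlatPresentation j q)
    (n : ℕ) : TorSuccVanishes R (n + 1) M X ↔ TorSuccVanishes R n M L := by
  induction n generalizing M with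
  | zero =>
    obtain ⟨K, F, _, _, _, _, i, p, h'⟩ := exists_flatPresentation R M
    have := h'.flat
    have := h.flat
    rw [torSuccVanishes_succ_iff h', torSuccVanishes_zero_iff_lTensor h,
      torSuccVanishes_zero_iff_rTensor h',
      lTensor_injective_iff_rTensor_injective_of_flat h'.inj h.inj]
  | succ n ih =>
    obtain ⟨K, F, _, _, _, _, i, p, h'⟩ := exists_flatPresentation R M
    rw [torSuccVanishes_succ_iff h', torSuccVanishes_succ_iff h', ih]

end

/-! ### Weak dimension through flat syzygies -/

/-- `w.d.(M) ≤ n`, for an unbundled module. -/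
def WeakDimLE (R : Type u) [CommRing R] (M : Type u) [AddCommGroup M] [Module R M] (n : ℕ) :
    Prop :=
  HasWeakDimensionLE (ModuleCat.of R M) n

section

variable {R : Type u} [CommRing R] {K F M L P X : Type u}
  [AddCommGroup K] [Module R K] [AddCommGroup F] [Module R F] [AddCommGroup M] [Module R M]
  [AddCommGroup L] [Module R L] [AddCommGroup P] [Module R P] [AddCommGroup X] [Module R X]

lemma WeakDimLE.torSuccVanishes {n : ℕ} (h : WeakDimLE R M n) (X : Type u) [AddCommGroup X]
    [Module R X] : TorSuccVanishes R n M X :=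
  h (ModuleCat.of R X)

lemma weakDimLE_zero_iff : WeakDimLE R M 0 ↔ Module.Flat R M := by
  constructor
  · intro h
    rw [Module.Flat.iff_lTensor_injective']
    intro I
    have hI : FlatPresentation I.subtype I.mkQ :=
      ⟨inferInstance, Subtype.val_injective, LinearMap.exact_subtype_mkQ I, I.mkQ_surjective⟩
    exact (torSuccVanishes_zero_iff_lTensor hI).1 (h.torSuccVanishes (R ⧸ I))
  · intro h N
    obtain ⟨_, _, _, _, _, _, j, q, h'⟩ := exists_flatPresentation R N
    exact (torSuccVanishes_zero_iff_lTensor h').2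
      (Module.Flat.lTensor_preserves_injective_linearMap j h'.inj)

/-- Together with `weakDimLE_zero_iff`, this computes weak dimensions by flat syzygies alone. -/
lemma FlatPresentation.weakDimLE_succ_iff {i : K →ₗ[R] F} {p : F →ₗ[R] M}
    (h : FlatPresentation i p) {n : ℕ} : WeakDimLE R M (n + 1) ↔ WeakDimLE R K n :=
  forall_congr' fun N ↦ torSuccVanishes_succ_iff (X := N) h n

lemma WeakDimLE.succ {n : ℕ} (h : WeakDimLE R M n) : WeakDimLE R M (n + 1) := by
  induction n generalizing M with
  | zero =>
    intro X
    obtain ⟨L, _, _, _, _, _, j, q, h'⟩ := exists_flatPresentation R X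
    exact (torSuccVanishes_succ_iff' (X := X) h' 0).2 (h.torSuccVanishes L)
  | succ n ih =>
    obtain ⟨K, F, _, _, _, _, i, p, h'⟩ := exists_flatPresentation R M
    rw [h'.weakDimLE_succ_iff] at h ⊢
    exact ih h

lemma WeakDimLE.mono {m n : ℕ} (h : WeakDimLE R M m) (hmn : m ≤ n) : WeakDimLE R M n := by
  induction n, hmn using Nat.le_induction with
  | base => exact h
  | succ n _ ih => exact ih.succ

/-- A bound for the weak dimension of the second variable makes `Tor` vanish as well. -/
lemma WeakDimLE.torSuccVanishes_right {n : ℕ} (h : WeakDimLE R X n) (M : Type u)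
    [AddCommGroup M] [Module R M] : TorSuccVanishes R n M X := by
  induction n generalizing X with
  | zero =>
    obtain ⟨_, _, _, _, _, _, i, _, h'⟩ := exists_flatPresentation R M
    have := weakDimLE_zero_iff.1 h
    exact (torSuccVanishes_zero_iff_rTensor h').2
      (Module.Flat.rTensor_preserves_injective_linearMap i h'.inj)
  | succ n ih =>
    obtain ⟨_, _, _, _, _, _, _, _, h'⟩ := exists_flatPresentation R X
    rw [torSuccVanishes_succ_iff' h']
    exact ih (h'.weakDimLE_succ_iff.1 h)

lemma exists_injective_embedding (R : Type u) [CommRing R] (X : Type u) [AddCommGroup X]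
    [Module R X] : ∃ (E : Type u) (_ : AddCommGroup E) (_ : Module R E) (f : X →ₗ[R] E),
      Module.Injective R E ∧ Function.Injective f := by
  let E : ModuleCat.{u} R := Injective.under (ModuleCat.of R X)
  refine ⟨E, inferInstance, inferInstance, (Injective.ι (ModuleCat.of R X)).hom, ?_, ?_⟩
  · exact (Module.injective_iff_injective_object R _).2 (Injective.injective_under _)
  · exact (ModuleCat.mono_iff_injective _).1 (Injective.ι_mono _)

/-- If `w.d.(M) ≤ n + 1`, then `Tor_{n+1}(M, -)` is left exact, so that it vanishes as soon as it
vanishes on injective modules. -/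
lemma weakDimLE_of_succ {n : ℕ} (hM : WeakDimLE R M (n + 1))
    (hE : ∀ (E : Type u) [AddCommGroup E] [Module R E], Module.Injective R E →
      TorSuccVanishes R n M E) : WeakDimLE R M n := by
  induction n generalizing M with
  | zero =>
    intro X
    obtain ⟨E, _, _, f, hEi, hf⟩ := exists_injective_embedding R X
    obtain ⟨K, F, _, _, _, _, i, p, h⟩ := exists_flatPresentation R M
    have hK := weakDimLE_zero_iff.1 (h.weakDimLE_succ_iff.1 hM)
    have hi := (torSuccVanishes_zero_iff_rTensor h).1 (hE E hEi)
    refine (torSuccVanishes_zero_iff_rTensor (X := X) h).2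
      (Function.Injective.of_comp (f := f.lTensor F) ?_)
    -- `K ⊗ X → K ⊗ E` is injective because `K` is flat, and `K ⊗ E → F ⊗ E` by hypothesis.
    have hc : f.lTensor F ∘ i.rTensor X = i.rTensor E ∘ f.lTensor K :=
      funext fun t ↦ (rTensor_lTensor_apply i f t).symm
    rw [hc]
    exact hi.comp (Module.Flat.lTensor_preserves_injective_linearMap f hf)
  | succ n ih =>
    obtain ⟨K, F, _, _, _, _, i, p, h⟩ := exists_flatPresentation R M
    rw [h.weakDimLE_succ_iff] at hM ⊢
    exact ih hM fun E _ _ hEi ↦ (torSuccVanishes_succ_iff h n).1 (hE E hEi)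

/-- The finitistic weak dimension is bounded by the weak dimensions of the injective modules. -/
lemma WeakDimLE.of_injective_le {d n : ℕ}
    (hd : ∀ (E : Type u) [AddCommGroup E] [Module R E], Module.Injective R E → WeakDimLE R E d)
    (hM : WeakDimLE R M n) : WeakDimLE R M d := by
  rcases le_total n d with hnd | hnd
  · exact hM.mono hnd
  induction n, hnd using Nat.le_induction with
  | base => exact hM
  | succ n hn ih =>
    exact ih (weakDimLE_of_succ hM fun E _ _ hE ↦ ((hd E hE).mono hn).torSuccVanishes_right M)

end

/-! ### Localization of weak dimensions -/

section

variable {R : Type u} [CommRing R] {K F M : Type u}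
  [AddCommGroup K] [Module R K] [AddCommGroup F] [Module R F] [AddCommGroup M] [Module R M]

lemma FlatPresentation.localizedModule (S : Submonoid R) {i : K →ₗ[R] F} {p : F →ₗ[R] M}
    (h : FlatPresentation i p) :
    FlatPresentation (LocalizedModule.map S i) (LocalizedModule.map S p) :=
  have := h.flat
  ⟨inferInstance, LocalizedModule.map_injective S i h.inj, LocalizedModule.map_exact S i p h.exact,
    LocalizedModule.map_surjective S p h.surj⟩

lemma WeakDimLE.localizedModule {n : ℕ} (S : Submonoid R) (h : WeakDimLE R M n) :
    WeakDimLE (Localization S) (LocalizedModule S M) n := by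
  induction n generalizing M with
  | zero =>
    rw [weakDimLE_zero_iff] at h ⊢
    infer_instance
  | succ n ih =>
    obtain ⟨K, F, _, _, _, _, i, p, h'⟩ := exists_flatPresentation R M
    exact (h'.localizedModule S).weakDimLE_succ_iff.2 (ih (h'.weakDimLE_succ_iff.1 h))

lemma weakDimLE_of_localized_maximal {n : ℕ}
    (h : ∀ (P : Ideal R) [P.IsMaximal],
      WeakDimLE (Localization.AtPrime P) (LocalizedModule P.primeCompl M) n) :
    WeakDimLE R M n := by
  induction n generalizing M with
  | zero =>
    rw [weakDimLE_zero_iff]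
    refine Module.flat_of_localized_maximal M fun P _ ↦ ?_
    exact (Module.flat_iff_of_isLocalization (Localization.AtPrime P) P.primeCompl _).1
      (weakDimLE_zero_iff.1 (h P))
  | succ n ih =>
    obtain ⟨K, F, _, _, _, _, i, p, h'⟩ := exists_flatPresentation R M
    exact h'.weakDimLE_succ_iff.2
      (ih fun P _ ↦ (h'.localizedModule P.primeCompl).weakDimLE_succ_iff.1 (h P))

lemma FlatPresentation.restrictScalars_of_isLocalization (S : Submonoid R) {Q : Type u}
    [CommRing Q] [Algebra R Q] [IsLocalization S Q] [Module Q K] [IsScalarTower R Q K]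
    [Module Q F] [IsScalarTower R Q F] [Module Q M] [IsScalarTower R Q M]
    {i : K →ₗ[Q] F} {p : F →ₗ[Q] M} (h : FlatPresentation i p) :
    FlatPresentation (i.restrictScalars R) (p.restrictScalars R) :=
  ⟨(Module.flat_iff_of_isLocalization Q S F).1 h.flat, h.inj, h.exact, h.surj⟩

/-- The weak dimension of a module over a localization does not depend on the base ring. -/
lemma weakDimLE_iff_of_isLocalization (S : Submonoid R) (Q : Type u) [CommRing Q] [Algebra R Q]
    [IsLocalization S Q] [Module Q M] [IsScalarTower R Q M] {n : ℕ} :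
    WeakDimLE Q M n ↔ WeakDimLE R M n := by
  induction n generalizing M with
  | zero =>
    rw [weakDimLE_zero_iff, weakDimLE_zero_iff]
    exact Module.flat_iff_of_isLocalization Q S M
  | succ n ih =>
    let p := Finsupp.linearCombination Q (id : M → M)
    have hp : Function.Surjective p := Finsupp.linearCombination_id_surjective Q M
    have hQ := flatPresentation_subtype_ker hp
    have hR := hQ.restrictScalars_of_isLocalization (R := R) S
    rw [hQ.weakDimLE_succ_iff, hR.weakDimLE_succ_iff, ih]

/-- A module over a localization is also a module over the base ring, of the same weak
dimension. -/
lemma exists_weakDimLE_iff_of_isLocalization (S : Submonoid R) (Q : Type u) [CommRing Q]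
    [Algebra R Q] [IsLocalization S Q] (M : Type u) [AddCommGroup M] [Module Q M] :
    ∃ (_ : Module R M), ∀ n, WeakDimLE R M n ↔ WeakDimLE Q M n := by
  let _ : Module R M := Module.compHom M (algebraMap R Q)
  have : IsScalarTower R Q M := IsScalarTower.of_algebraMap_smul fun _ _ ↦ rfl
  exact ⟨inferInstance, fun n ↦ (weakDimLE_iff_of_isLocalization S Q).symm⟩

end

/-! ### The finitistic weak dimension -/

section

variable {R : Type u} [CommRing R]

lemma weakDimension_le_iff {M : ModuleCat.{u} R} {n : ℕ} :
    weakDimension M ≤ n ↔ WeakDimLE R M n := by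
  constructor
  · intro h
    have hlt : weakDimension M < (n + 1 : ℕ) := lt_of_le_of_lt h (by exact_mod_cast n.lt_succ_self)
    simp only [weakDimension, iInf_lt_iff] at hlt
    obtain ⟨m, hm, hmn⟩ := hlt
    exact WeakDimLE.mono (M := M) hm (Nat.lt_succ_iff.1 (by exact_mod_cast hmn))
  · intro h
    exact iInf₂_le n h

lemma weakDimension_lt_top_iff {M : ModuleCat.{u} R} :
    weakDimension M < ⊤ ↔ ∃ n, WeakDimLE R M n := by
  constructor
  · intro h
    obtain ⟨n, hn⟩ := ENat.ne_top_iff_exists.1 h.ne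
    exact ⟨n, weakDimension_le_iff.1 hn.symm.le⟩
  · rintro ⟨n, hn⟩
    exact lt_of_le_of_lt (weakDimension_le_iff.2 hn) (ENat.natCast_lt_top n)

lemma finitisticWeakDimension_le_iff {d : ℕ} :
    finitisticWeakDimension R ≤ d ↔
      ∀ (M : Type u) [AddCommGroup M] [Module R M] (n : ℕ), WeakDimLE R M n → WeakDimLE R M d := by
  simp only [finitisticWeakDimension, iSup_le_iff, weakDimension_le_iff, weakDimension_lt_top_iff]
  exact ⟨fun h M _ _ n hn ↦ h (ModuleCat.of R M) ⟨n, hn⟩, fun h M ⟨n, hn⟩ ↦ h M n hn⟩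

lemma succ_le_finitisticWeakDimension {d n : ℕ} (M : Type u) [AddCommGroup M] [Module R M]
    (hn : WeakDimLE R M n) (hd : ¬ WeakDimLE R M d) :
    ((d + 1 : ℕ) : ℕ∞) ≤ finitisticWeakDimension R := by
  by_contra! h
  refine hd (finitisticWeakDimension_le_iff.1 ?_ M n hn)
  rw [Nat.cast_add, Nat.cast_one] at h
  exact ENat.lt_add_one_iff (ENat.natCast_ne_top d) |>.1 h

end

/-! ### Modules over chain rings -/

/-- Mathlib's `PreValuationRing` asks for a total divisibility relation, which for a commutative ring
means a total order on the ideals; zero divisors are allowed. -/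
lemma IsChainRing.preValuationRing {R : Type u} [CommRing R] (h : IsChainRing R) :
    PreValuationRing R :=
  PreValuationRing.iff_ideal_total.2 ⟨h⟩

lemma eq_zero_of_mul_one_sub_eq_zero {R : Type u} [CommRing R] [IsLocalRing R] {x t s : R}
    (ht : ¬ IsUnit t) (h : x * (1 - t * s) = 0) : x = 0 :=
  (IsLocalRing.isUnit_one_sub_self_of_mem_nonunits (t * s)
    fun hu ↦ ht (isUnit_of_mul_isUnit_left hu)).mul_left_eq_zero.1 h

section

variable {R : Type u} [CommRing R] [PreValuationRing R] {M : Type u} [AddCommGroup M] [Module R M]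

lemma isPrincipal_of_fg (I : Ideal R) (hI : I.FG) : I.IsPrincipal := by
  have : IsBezout R := by
    rw [IsBezout.iff_span_pair_isPrincipal]
    intro x y
    rcases ValuationRing.dvd_total x y with h | h
    · exact ⟨x, by
        rw [Ideal.span_insert, sup_eq_left.2 (Ideal.span_singleton_le_span_singleton.2 h)]⟩
    · exact ⟨y, by
        rw [Ideal.span_insert, sup_eq_right.2 (Ideal.span_singleton_le_span_singleton.2 h)]⟩
  exact IsBezout.isPrincipal_of_FG I hI

/-- Over a chain ring, an element of `(0 : a) M` is of the form `b • m` with `a * b = 0`. -/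
lemma exists_eq_smul_of_flat [Module.Flat R M] {a : R} {m : M} (h : a • m = 0) :
    ∃ (b : R) (m' : M), a * b = 0 ∧ m = b • m' := by
  have h' : ∑ i : Fin 1, (fun _ ↦ a) i • (fun _ ↦ m) i = 0 := by simpa using h
  obtain ⟨k, c, y, hy, hc⟩ := Module.Flat.isTrivialRelation_of_sum_smul_eq_zero h'
  have hsum : ∀ s : Finset (Fin k), ∃ (b : R) (m' : M), a * b = 0 ∧
      ∑ j ∈ s, c 0 j • y j = b • m' := by
    classical
    intro s
    induction s using Finset.induction_on with
    | empty => exact ⟨0, 0, by simp, by simp⟩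
    | insert j s hj ih =>
      obtain ⟨b, m', hb, hs⟩ := ih
      have hcj : a * c 0 j = 0 := by simpa using hc j
      rw [Finset.sum_insert hj, hs]
      rcases ValuationRing.dvd_total b (c 0 j) with ⟨z, hz⟩ | ⟨z, hz⟩
      · exact ⟨b, z • y j + m', hb, by rw [hz, mul_smul, smul_add]⟩
      · exact ⟨c 0 j, y j + z • m', hcj, by rw [hz, mul_smul, smul_add]⟩
  obtain ⟨b, m', hb, hs⟩ := hsum Finset.univ
  exact ⟨b, m', hb, (hy 0).trans hs⟩

/-- Finitely generated ideals of a chain ring are principal, so that flatness of `M` only has to be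
tested on the ideals `(a)`, where it says that the elements of `M` killed by `a` lie in `(0 : a) M`. -/
lemma flat_of_forall_exists_eq_smul
    (h : ∀ (a : R) (m : M), a • m = 0 → ∃ (b : R) (m' : M), a * b = 0 ∧ m = b • m') :
    Module.Flat R M := by
  rw [Module.Flat.iff_rTensor_injective]
  intro I hI
  obtain ⟨a, rfl⟩ := (isPrincipal_of_fg I hI).principal
  let g : R →ₗ[R] Ideal.span {a} :=
    (LinearMap.toSpanSingleton R R a).codRestrict _ fun x ↦ Ideal.mem_span_singleton'.2 ⟨x, rfl⟩
  have hg : Function.Surjective g := fun ⟨x, hx⟩ ↦ by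
    obtain ⟨y, rfl⟩ := Ideal.mem_span_singleton'.1 hx
    exact ⟨y, rfl⟩
  rw [injective_iff_map_eq_zero]
  intro t ht
  obtain ⟨t, rfl⟩ := LinearMap.rTensor_surjective M hg t
  obtain ⟨m, rfl⟩ := (TensorProduct.lid R M).symm.surjective t
  have ham : a • m = 0 := by
    have := congrArg (TensorProduct.lid R M) ht
    simpa [g] using this
  obtain ⟨b, m', hab, rfl⟩ := h a m ham
  have hbg : b • g 1 = 0 := Subtype.ext (by simp [g, mul_comm b a, hab])
  rw [TensorProduct.lid_symm_apply, LinearMap.rTensor_tmul, TensorProduct.tmul_smul]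
  exact (TensorProduct.smul_tmul' b (g 1) m').trans (by rw [hbg, TensorProduct.zero_tmul])

/-- Vanishing of `Tor₂(M, R/bR)` for all `b`, in terms of elements of `M`: the first syzygy `K` of
`M` is flat because the elements of `K` killed by `b` lie in `(0 : b) K`. -/
lemma weakDimLE_one_of_forall
    (h : ∀ (b c : R) (e : M), b * c = 0 → c • e = 0 → ∃ (d z w : R) (y : M),
      b * d = 0 ∧ c = d * z ∧ d * w = 0 ∧ z • e = w • y) :
    WeakDimLE R M 1 := by
  obtain ⟨K, F, _, _, _, _, i, p, H⟩ := exists_flatPresentation R M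
  have := H.flat
  rw [H.weakDimLE_succ_iff, weakDimLE_zero_iff]
  refine flat_of_forall_exists_eq_smul fun b k hk ↦ ?_
  obtain ⟨c, f, hc, hf⟩ := exists_eq_smul_of_flat (a := b) (m := i k)
    (by rw [← map_smul, hk, map_zero])
  have he : c • p f = 0 := by
    rw [← map_smul, ← hf]
    exact H.exact.apply_apply_eq_zero k
  obtain ⟨d, z, w, y, hd, rfl, hw, hy⟩ := h b c (p f) hc he
  obtain ⟨g, rfl⟩ := H.surj y
  obtain ⟨k', hk'⟩ := (H.exact (z • f - w • g)).1 (by simp [hy])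
  -- `d * w = 0`, so `d • (z • f - w • g) = c • f`.
  refine ⟨d, k', hd, H.inj ?_⟩
  rw [map_smul, hk', hf, smul_sub, smul_smul, smul_smul, hw, zero_smul, sub_zero]

/-- Converse of `weakDimLE_one_of_forall`. -/
lemma WeakDimLE.exists_of_one (h : WeakDimLE R M 1) {b c : R} {e : M} (hbc : b * c = 0)
    (hce : c • e = 0) : ∃ (d z w : R) (y : M),
      b * d = 0 ∧ c = d * z ∧ d * w = 0 ∧ z • e = w • y := by
  obtain ⟨K, F, _, _, _, _, i, p, H⟩ := exists_flatPresentation R M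
  have := H.flat
  rw [H.weakDimLE_succ_iff, weakDimLE_zero_iff] at h
  obtain ⟨f, rfl⟩ := H.surj e
  obtain ⟨k, hk⟩ := (H.exact (c • f)).1 (by rw [map_smul, hce])
  obtain ⟨d, k', hd, rfl⟩ := exists_eq_smul_of_flat (a := b) (m := k)
    (H.inj (by rw [map_smul, hk, smul_smul, hbc, zero_smul, map_zero]))
  rw [map_smul] at hk
  rcases ValuationRing.dvd_total d c with ⟨z, rfl⟩ | ⟨z, rfl⟩
  · obtain ⟨w, g, hw, hg⟩ := exists_eq_smul_of_flat (a := d) (m := z • f - i k')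
      (by rw [smul_sub, hk, smul_smul, sub_self])
    refine ⟨d, z, w, p g, hd, rfl, hw, ?_⟩
    rw [← map_smul, ← map_smul, ← hg, map_sub, H.exact.apply_apply_eq_zero, sub_zero]
  · obtain ⟨w, g, hw, hg⟩ := exists_eq_smul_of_flat (a := c) (m := f - z • i k')
      (by rw [smul_sub, ← hk, smul_smul, sub_self])
    refine ⟨c, 1, w, p g, hbc, (mul_one c).symm, hw, ?_⟩
    rw [one_smul, ← map_smul, ← hg, map_sub, map_smul, H.exact.apply_apply_eq_zero, smul_zero,
      sub_zero]

/-- In an injective module, `e` is divisible by `w` as soon as `(0 : w)` kills `e`: extend the map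
`w ↦ e` from the ideal `(w)` to the whole ring. -/
lemma exists_eq_smul_of_injective {R : Type u} [CommRing R] {E : Type u} [AddCommGroup E]
    [Module R E] (hE : Module.Injective R E) {w : R} {e : E}
    (h : ∀ r : R, r * w = 0 → r • e = 0) : ∃ y : E, e = w • y := by
  have hk : LinearMap.ker (LinearMap.toSpanSingleton R R w) ≤
      LinearMap.ker (LinearMap.toSpanSingleton R E e) := fun r hr ↦ by
    simpa using h r (by simpa using hr)
  let φ := LinearMap.toSpanSingleton R R w
  let ψ := LinearMap.toSpanSingleton R E e
  obtain ⟨f, hf⟩ := Module.Injective.extension_property R E _ _ ((LinearMap.ker φ).liftQ φ le_rfl)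
    (LinearMap.ker_eq_bot.1 (Submodule.ker_liftQ_eq_bot _ _ _ le_rfl))
    ((LinearMap.ker φ).liftQ ψ hk)
  refine ⟨f 1, ?_⟩
  have := LinearMap.congr_fun hf (Submodule.Quotient.mk 1)
  simp only [LinearMap.comp_apply, Submodule.liftQ_apply, φ, ψ,
    LinearMap.toSpanSingleton_apply, one_smul] at this
  rw [← this, ← map_smul, smul_eq_mul, mul_one]

end

/-! ### Chain rings whose regular elements are units -/

section

variable {Q : Type u} [CommRing Q]

/-- The annihilator of `a` is a principal ideal. -/
def HasPrincipalAnnihilator (a : Q) : Prop :=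
  ∃ b, a * b = 0 ∧ ∀ x, a * x = 0 → b ∣ x

lemma exists_ne_zero_mul_eq_zero (hQ : nonZeroDivisors Q ≤ IsUnit.submonoid Q) {a : Q}
    (ha : ¬ IsUnit a) : ∃ y, y ≠ 0 ∧ a * y = 0 := by
  by_contra! h
  exact ha (hQ (mem_nonZeroDivisors_iff_right.2 fun x hx ↦
    by_contra fun hx0 ↦ h x hx0 (mul_comm x a ▸ hx)))

variable [PreValuationRing Q]

/-- In a chain ring whose regular elements are units, `(0 : (0 : a)) = (a)`. The hypothesis that
regular elements are units is written `nonZeroDivisors Q ≤ IsUnit.submonoid Q`. -/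
lemma dvd_of_forall_mul_eq_zero (hQ : nonZeroDivisors Q ≤ IsUnit.submonoid Q) {a c : Q}
    (h : ∀ x, a * x = 0 → c * x = 0) : a ∣ c := by
  by_contra hac
  obtain ⟨z, rfl⟩ := (ValuationRing.dvd_total a c).resolve_left hac
  have hz : ¬ IsUnit z := fun hz ↦ hac (hz.mul_right_dvd.2 dvd_rfl)
  obtain ⟨y, hy0, hy⟩ := exists_ne_zero_mul_eq_zero hQ hz
  rcases ValuationRing.dvd_total c y with ⟨d, rfl⟩ | ⟨d, rfl⟩
  · exact hy0 (h d (by rw [← hy]; ring))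
  · have h0 : y * d * z = 0 := by rw [mul_right_comm, mul_comm y z, hy, zero_mul]
    have := h 1 (by rw [h0, zero_mul])
    rw [mul_one] at this
    exact hac (this ▸ dvd_zero _)

lemma isIFRing_of_forall_hasPrincipalAnnihilator
    (hQ : nonZeroDivisors Q ≤ IsUnit.submonoid Q)
    (h : ∀ a : Q, HasPrincipalAnnihilator a) : IsIFRing Q := by
  intro E _ _ hE
  refine flat_of_forall_exists_eq_smul fun a m ham ↦ ?_
  obtain ⟨b, hab, hb⟩ := h a
  obtain ⟨y, hy⟩ := exists_eq_smul_of_injective hE (w := b) (e := m) fun r hr ↦ by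
    have har : a ∣ r := dvd_of_forall_mul_eq_zero hQ fun x hx ↦ by
      obtain ⟨t, rfl⟩ := hb x hx
      rw [← mul_assoc, hr, zero_mul]
    obtain ⟨t, rfl⟩ := har
    rw [mul_comm, mul_smul, ham, smul_zero]
  exact ⟨b, y, hab, hy⟩

lemma exists_ne_zero_not_isUnit (hQ : nonZeroDivisors Q ≤ IsUnit.submonoid Q)
    (hIF : ¬ IsIFRing Q) : ∃ c : Q, c ≠ 0 ∧ ¬ IsUnit c := by
  by_contra! h
  refine hIF (isIFRing_of_forall_hasPrincipalAnnihilator hQ fun a ↦ ?_)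
  by_cases ha : a = 0
  · exact ⟨1, by rw [ha, zero_mul], fun x _ ↦ one_dvd x⟩
  · exact ⟨0, mul_zero a, fun x hx ↦ zero_dvd_iff.2 ((h a ha).mul_right_eq_zero.1 hx)⟩

variable [IsLocalRing Q]

/-- In a chain ring whose regular elements are units, one nonzero principal annihilator of a
nonzero element makes all annihilators of elements principal. -/
lemma HasPrincipalAnnihilator.of_mul_eq_zero (hQ : nonZeroDivisors Q ≤ IsUnit.submonoid Q)
    {a b : Q} (ha : a ≠ 0) (hb : b ≠ 0) (hab : a * b = 0) (h : ∀ x, a * x = 0 → b ∣ x) (c : Q) :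
    HasPrincipalAnnihilator c := by
  rcases ValuationRing.dvd_total c a with ⟨d, rfl⟩ | ⟨d, rfl⟩
  · refine ⟨d * b, by rw [← mul_assoc, hab], fun x hx ↦ ?_⟩
    obtain ⟨y, rfl⟩ := h x (by rw [mul_right_comm, hx, zero_mul])
    suffices hdy : d ∣ y by
      rw [mul_comm d b]
      exact mul_dvd_mul_left b hdy
    by_contra hdy
    obtain ⟨t, rfl⟩ := (ValuationRing.dvd_total d y).resolve_left hdy
    have ht : ¬ IsUnit t := fun ht ↦ hdy (ht.mul_right_dvd.2 dvd_rfl)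
    obtain ⟨s, hs⟩ : c * (y * t) ∣ y * c := dvd_of_forall_mul_eq_zero hQ fun x' hx' ↦ by
      obtain ⟨v, rfl⟩ := h x' hx'
      linear_combination v * hx
    exact ha (eq_zero_of_mul_one_sub_eq_zero ht (s := s) (by linear_combination t * hs))
  · by_cases hc : a * d = 0
    · exact ⟨1, by rw [hc, zero_mul], fun x _ ↦ one_dvd x⟩
    obtain ⟨e, rfl⟩ := (ValuationRing.dvd_total b d).resolve_left fun ⟨t, ht⟩ ↦
      hc (by rw [ht, ← mul_assoc, hab, zero_mul])
    refine ⟨e, by rw [mul_assoc, hab], fun x hx ↦ ?_⟩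
    obtain ⟨y, hy⟩ := h (d * x) (by rw [← mul_assoc, hx])
    by_contra hex
    obtain ⟨t, rfl⟩ := (ValuationRing.dvd_total e x).resolve_left hex
    have ht : ¬ IsUnit t := fun ht ↦ hex (ht.mul_right_dvd.2 dvd_rfl)
    exact hb (eq_zero_of_mul_one_sub_eq_zero ht (s := y) (by linear_combination t * hy))

lemma not_hasPrincipalAnnihilator (hQ : nonZeroDivisors Q ≤ IsUnit.submonoid Q)
    (hIF : ¬ IsIFRing Q) {c : Q} (hc0 : c ≠ 0) (hc : ¬ IsUnit c) :
    ¬ HasPrincipalAnnihilator c := by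
  rintro ⟨b, hcb, hb⟩
  obtain ⟨y, hy0, hy⟩ := exists_ne_zero_mul_eq_zero hQ hc
  have hb0 : b ≠ 0 := fun h0 ↦ hy0 (zero_dvd_iff.1 (h0 ▸ hb y hy))
  exact hIF (isIFRing_of_forall_hasPrincipalAnnihilator hQ
    (HasPrincipalAnnihilator.of_mul_eq_zero hQ hc0 hb0 hcb hb))

/-- If such a ring is not IF, the annihilator of a nonzero nonunit `c` is not principal: each nonzero
`d` in it fails to divide some other element of it. -/
lemma exists_mul_eq_zero_not_dvd (hQ : nonZeroDivisors Q ≤ IsUnit.submonoid Q)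
    (hIF : ¬ IsIFRing Q) {c d : Q} (hc0 : c ≠ 0) (hd0 : d ≠ 0) (hcd : c * d = 0) :
    ∃ x, c * x = 0 ∧ ¬ d ∣ x := by
  by_contra! h
  exact not_hasPrincipalAnnihilator hQ hIF hc0 (fun hc ↦ hd0 (hc.mul_right_eq_zero.1 hcd))
    ⟨d, hcd, h⟩

/-- The first syzygy `K` of an injective module `E` satisfies the criterion
`weakDimLE_one_of_forall`: an element of `K` killed by `c = d * z`, with `z` a nonunit, has the form
`a • f` with `c * a = 0`, and if `z * a ≠ 0`, the image of `f` in `E` is divisible by some element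
of `(0 : z * a)`. -/
lemma weakDimLE_two_of_injective (hQ : nonZeroDivisors Q ≤ IsUnit.submonoid Q)
    (hIF : ¬ IsIFRing Q) {E : Type u} [AddCommGroup E] [Module Q E] (hE : Module.Injective Q E) :
    WeakDimLE Q E 2 := by
  obtain ⟨K, F, _, _, _, _, i, p, H⟩ := exists_flatPresentation Q E
  have := H.flat
  rw [H.weakDimLE_succ_iff]
  refine weakDimLE_one_of_forall fun b c k hbc hck ↦ ?_
  by_cases hb : b = 0
  · exact ⟨1, c, 0, 0, by rw [hb, zero_mul], (one_mul c).symm, mul_zero _,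
      by rw [hck, zero_smul]⟩
  by_cases hc : c = 0
  · exact ⟨0, 0, 0, 0, mul_zero b, by rw [hc, mul_zero], mul_zero _, by rw [zero_smul, zero_smul]⟩
  -- `(0 : b)` is not principal, so it contains a proper divisor `d` of `c`.
  obtain ⟨d, hbd, hcd⟩ := exists_mul_eq_zero_not_dvd hQ hIF hb hc hbc
  obtain ⟨z, rfl⟩ := (ValuationRing.dvd_total c d).resolve_left hcd
  have hz : ¬ IsUnit z := fun hz ↦ hcd (hz.mul_right_dvd.2 dvd_rfl)
  obtain ⟨a, f, hca, hf⟩ := exists_eq_smul_of_flat (a := d * z) (m := i k)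
    (by rw [← map_smul, hck, map_zero])
  by_cases hza : z * a = 0
  · exact ⟨d, z, 0, 0, hbd, rfl, mul_zero d, H.inj (by
      rw [map_smul, hf, smul_smul, hza, zero_smul, zero_smul, map_zero])⟩
  have hae : a • p f = 0 := by
    rw [← map_smul, ← hf, H.exact.apply_apply_eq_zero]
  -- Otherwise `a ∈ (0 : (0 : z * a)) = (z * a)`, which is impossible as `z` is not a unit.
  obtain ⟨w, hw, hwa⟩ : ∃ w, z * a * w = 0 ∧ a * w ≠ 0 := by
    by_contra! h
    obtain ⟨s, hs⟩ := dvd_of_forall_mul_eq_zero hQ h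
    have ha : a = 0 := eq_zero_of_mul_one_sub_eq_zero hz (s := s) (by linear_combination hs)
    exact hza (by rw [ha, mul_zero])
  obtain ⟨y, hy⟩ := exists_eq_smul_of_injective hE (w := w) (e := p f) fun r hr ↦ by
    rcases ValuationRing.dvd_total a r with ⟨t, rfl⟩ | ⟨t, rfl⟩
    · rw [mul_comm, mul_smul, hae, smul_zero]
    · exact absurd (by rw [mul_right_comm, hr, zero_mul]) hwa
  obtain ⟨g, rfl⟩ := H.surj y
  obtain ⟨k', hk'⟩ := (H.exact (f - w • g)).1 (by rw [map_sub, map_smul, hy, sub_self])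
  refine ⟨d, z, z * a, k', hbd, rfl, by rw [← mul_assoc, hca], H.inj ?_⟩
  rw [map_smul, map_smul, hk', hf, smul_sub, smul_smul, smul_smul (z * a), hw, zero_smul, sub_zero]

/-- An injective module with an element `e` whose annihilator is `(c)`, for a nonzero nonunit `c`,
violates the criterion `WeakDimLE.exists_of_one`. -/
lemma exists_injective_not_weakDimLE_one (hQ : nonZeroDivisors Q ≤ IsUnit.submonoid Q)
    (hIF : ¬ IsIFRing Q) : ∃ (E : Type u) (_ : AddCommGroup E) (_ : Module Q E),
      Module.Injective Q E ∧ ¬ WeakDimLE Q E 1 := by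
  obtain ⟨c, hc0, hc⟩ := exists_ne_zero_not_isUnit hQ hIF
  obtain ⟨E, _, _, φ, hE, hφ⟩ := exists_injective_embedding Q (Q ⧸ Ideal.span {c})
  refine ⟨E, inferInstance, inferInstance, hE, fun h ↦ ?_⟩
  let e : E := φ (Ideal.Quotient.mk _ 1)
  have he : ∀ r : Q, r • e = 0 ↔ c ∣ r := fun r ↦ by
    rw [← map_smul, map_eq_zero_iff φ hφ, ← Ideal.mem_span_singleton,
      ← Ideal.Quotient.eq_zero_iff_mem, Algebra.smul_def, Ideal.Quotient.algebraMap_eq, map_one,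
      mul_one]
  obtain ⟨b, hb0, hcb⟩ := exists_ne_zero_mul_eq_zero hQ hc
  obtain ⟨d, z, w, y, hbd, rfl, hdw, hy⟩ :=
    h.exists_of_one (b := b) (c := c) (e := e) (by rw [mul_comm, hcb]) ((he c).2 dvd_rfl)
  have hd0 : d ≠ 0 := left_ne_zero_of_mul hc0
  have hd : ¬ IsUnit d := fun hd ↦ hb0 (hd.mul_left_eq_zero.1 hbd)
  by_cases hw0 : w = 0
  · obtain ⟨s, hs⟩ := (he z).1 (by rw [hy, hw0, zero_smul])
    exact hc0 (eq_zero_of_mul_one_sub_eq_zero hd (s := s) (by linear_combination d * hs))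
  · obtain ⟨r, hwr, hdr⟩ := exists_mul_eq_zero_not_dvd hQ hIF hw0 hd0 (mul_comm d w ▸ hdw)
    obtain ⟨s, hs⟩ := (he (r * z)).1 (by
      rw [mul_smul, hy, smul_smul, mul_comm, hwr, zero_smul])
    obtain ⟨t, rfl⟩ := (ValuationRing.dvd_total d r).resolve_left hdr
    have ht : ¬ IsUnit t := fun ht ↦ hdr (ht.mul_right_dvd.2 dvd_rfl)
    have hrz : r * z = 0 := eq_zero_of_mul_one_sub_eq_zero ht (s := s) (by linear_combination hs)
    exact hc0 (by rw [mul_right_comm, hrz, zero_mul])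

end

/-! ### Chain rings and their total rings of fractions -/

section

variable {R : Type u} [CommRing R] (Q : Type u) [CommRing Q] [Algebra R Q]

lemma preValuationRing_of_isLocalization (S : Submonoid R) [IsLocalization S Q]
    [PreValuationRing R] : PreValuationRing Q := by
  rw [PreValuationRing.iff_dvd_total]
  constructor
  have key : ∀ (a b : R) (s t : S), a ∣ b →
      IsLocalization.mk' Q a s ∣ IsLocalization.mk' Q b t := by
    rintro a _ s t ⟨c, rfl⟩
    refine ⟨IsLocalization.mk' Q (c * s) t, ?_⟩
    rw [← IsLocalization.mk'_mul, IsLocalization.mk'_eq_iff_eq]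
    congr 1
    push_cast
    ring
  intro x y
  obtain ⟨a, s, rfl⟩ := IsLocalization.exists_mk'_eq S x
  obtain ⟨b, t, rfl⟩ := IsLocalization.exists_mk'_eq S y
  exact (ValuationRing.dvd_total a b).imp (key a b s t) (key b a t s)

lemma nonZeroDivisors_le_isUnit_of_isFractionRing [IsFractionRing R Q] :
    nonZeroDivisors Q ≤ IsUnit.submonoid Q := by
  intro x hx
  obtain ⟨a, s, rfl⟩ := IsLocalization.exists_mk'_eq (nonZeroDivisors R) x
  have ha : a ∈ nonZeroDivisors R := mem_nonZeroDivisors_iff_right.2 fun r hr ↦ by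
    apply IsFractionRing.injective R Q
    rw [map_zero]
    refine mem_nonZeroDivisors_iff_right.1 hx _ ?_
    rw [IsLocalization.mul_mk'_eq_mk'_of_mul, hr, IsLocalization.mk'_zero]
  exact (IsLocalization.mk'_eq_mul_mk'_one a s (S := Q)) ▸
    (IsLocalization.map_units Q ⟨a, ha⟩).mul
      (IsUnit.of_mul_eq_one (algebraMap R Q s) (IsLocalization.mk'_spec Q 1 s ▸ map_one _))

variable [PreValuationRing R]

/-- For `a` in a semicoherent chain ring there is `b` with `a * b = 0` and
`(0 : b) ⊆ (0 : (0 : a))`. It comes from the flat module containing `Hom(E, F)`, applied to the map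
`E → E / aE → F` for injective modules `E ⊇ R` and `F ⊇ E / aE`. -/
lemma IsSemicoherentRing.exists_mul_eq_zero (h : IsSemicoherentRing R) (a : R) :
    ∃ b, a * b = 0 ∧ ∀ r, r * b = 0 → ∀ t, a * t = 0 → r * t = 0 := by
  obtain ⟨E, _, _, f, hE, hf⟩ := exists_injective_embedding R R
  let N : Submodule R E := LinearMap.range (LinearMap.lsmul R E a)
  obtain ⟨F, _, _, g, hF, hg⟩ := exists_injective_embedding R (E ⧸ N)
  obtain ⟨G, _, _, Φ, hG, hΦ⟩ := h E F hE hF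
  let φ : E →ₗ[R] F := g ∘ₗ N.mkQ
  have hφ : ∀ r : R, r • φ = 0 ↔ ∀ e, r • e ∈ N := fun r ↦ by
    rw [LinearMap.ext_iff]
    refine forall_congr' fun e ↦ ?_
    rw [LinearMap.smul_apply, ← map_smul, LinearMap.comp_apply, LinearMap.zero_apply,
      map_eq_zero_iff g hg, Submodule.mkQ_apply, Submodule.Quotient.mk_eq_zero]
  obtain ⟨b, γ, hab, hγ⟩ := exists_eq_smul_of_flat (a := a) (m := Φ φ) (by
    rw [← map_smul, (hφ a).2 fun e ↦ ⟨e, rfl⟩, map_zero])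
  refine ⟨b, hab, fun r hr t ht ↦ hf ?_⟩
  obtain ⟨y, hy⟩ := (hφ r).1 (hΦ (by rw [map_smul, hγ, smul_smul, hr, zero_smul, map_zero])) (f 1)
  calc f (r * t) = t • r • f 1 := by rw [smul_smul, ← map_smul, smul_eq_mul, mul_one, mul_comm]
    _ = t • a • y := by rw [← hy]; rfl
    _ = f 0 := by rw [smul_smul, mul_comm, ht, zero_smul, map_zero]

lemma IsSemicoherentRing.isIFRing [IsFractionRing R Q] (h : IsSemicoherentRing R) :
    IsIFRing Q := by
  have := preValuationRing_of_isLocalization Q (nonZeroDivisors R)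
  have hQ := nonZeroDivisors_le_isUnit_of_isFractionRing (R := R) Q
  have hmul : ∀ (a r : R) (s t : nonZeroDivisors R),
      IsLocalization.mk' Q a s * IsLocalization.mk' Q r t = 0 ↔ a * r = 0 := fun a r s t ↦ by
    rw [← IsLocalization.mk'_mul, IsLocalization.mk'_eq_zero_iff]
    exact ⟨fun ⟨m, hm⟩ ↦ mem_nonZeroDivisors_iff_right.1 m.2 _ (mul_comm (m : R) _ ▸ hm),
      fun h ↦ ⟨1, by rw [h, mul_zero]⟩⟩
  refine isIFRing_of_forall_hasPrincipalAnnihilator hQ fun q ↦ ?_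
  obtain ⟨a, s, rfl⟩ := IsLocalization.exists_mk'_eq (nonZeroDivisors R) q
  obtain ⟨b, hab, hb⟩ := h.exists_mul_eq_zero a
  refine ⟨IsLocalization.mk' Q b (1 : nonZeroDivisors R), (hmul _ _ _ _).2 hab, fun x hx ↦
    dvd_of_forall_mul_eq_zero hQ fun y hy ↦ ?_⟩
  obtain ⟨r, t, rfl⟩ := IsLocalization.exists_mk'_eq (nonZeroDivisors R) x
  obtain ⟨u, v, rfl⟩ := IsLocalization.exists_mk'_eq (nonZeroDivisors R) y
  rw [hmul] at hx hy ⊢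
  rw [mul_comm]
  exact hb u (mul_comm b u ▸ hy) r hx

end

section

variable {R : Type u} [CommRing R]

/-- Injective modules are divisible by regular elements, so `Hom(E, F)` embeds into its localization
at the regular elements, and then into an injective module over the total ring of fractions. -/
lemma isSemicoherentRing_of_isIFRing (h : IsIFRing (Localization (nonZeroDivisors R))) :
    IsSemicoherentRing R := by
  intro E F _ _ _ _ hE hF
  let S := nonZeroDivisors R
  obtain ⟨G, _, _, f, hG, hf⟩ :=
    exists_injective_embedding (Localization S) (LocalizedModule S (E →ₗ[R] F))
  let _ : Module R G := Module.compHom G (algebraMap R (Localization S))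
  have : IsScalarTower R (Localization S) G := IsScalarTower.of_algebraMap_smul fun _ _ ↦ rfl
  refine ⟨G, inferInstance, inferInstance,
    f.restrictScalars R ∘ₗ LocalizedModule.mkLinearMap S (E →ₗ[R] F),
    (Module.flat_iff_of_isLocalization (Localization S) S G).1 (h G hG), hf.comp ?_⟩
  rw [injective_iff_map_eq_zero]
  intro φ hφ
  obtain ⟨s, hs⟩ := (IsLocalizedModule.eq_zero_iff S (LocalizedModule.mkLinearMap S _)).1 hφ
  ext e
  obtain ⟨y, rfl⟩ := exists_eq_smul_of_injective hE (w := (s : R)) (e := e) fun r hr ↦ by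
    rw [mem_nonZeroDivisors_iff_right.1 s.2 r hr, zero_smul]
  rw [map_smul]
  exact LinearMap.congr_fun hs y

/-- A torsion-free module over a chain ring is flat if its localization at the regular elements
is. -/
lemma flat_of_flat_localizedModule [PreValuationRing R] {X : Type u} [AddCommGroup X] [Module R X]
    (htf : ∀ s ∈ nonZeroDivisors R, ∀ x : X, s • x = 0 → x = 0)
    (h : Module.Flat (Localization (nonZeroDivisors R)) (LocalizedModule (nonZeroDivisors R) X)) :
    Module.Flat R X := by
  let S := nonZeroDivisors R
  have hR : Module.Flat R (LocalizedModule S X) :=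
    (Module.flat_iff_of_isLocalization (Localization S) S _).1 h
  refine flat_of_forall_exists_eq_smul fun b k hk ↦ ?_
  obtain ⟨c, ξ, hbc, hξ⟩ := exists_eq_smul_of_flat (a := b)
    (m := LocalizedModule.mkLinearMap S X k) (by rw [← map_smul, hk, map_zero])
  obtain ⟨⟨x, s⟩, hx⟩ := IsLocalizedModule.surj S (LocalizedModule.mkLinearMap S X) ξ
  have hx' : (s : R) • ξ = LocalizedModule.mkLinearMap S X x := hx
  have hk' : (s : R) • k = c • x := by
    rw [← sub_eq_zero]
    obtain ⟨t, ht⟩ := (IsLocalizedModule.eq_zero_iff S (LocalizedModule.mkLinearMap S X)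
      (m := (s : R) • k - c • x)).1 (by
        rw [map_sub, map_smul, map_smul, hξ, ← hx', smul_comm, sub_self])
    exact htf t t.2 _ ht
  rcases ValuationRing.dvd_total c (s : R) with ⟨z, hz⟩ | ⟨z, rfl⟩
  · have hb : b = 0 := mem_nonZeroDivisors_iff_right.1 s.2 b (by
      rw [hz, ← mul_assoc, hbc, zero_mul])
    exact ⟨1, k, by rw [hb, zero_mul], (one_smul R k).symm⟩
  · refine ⟨z, x, mem_nonZeroDivisors_iff_right.1 s.2 _ (by rw [← hbc]; ring), ?_⟩
    rw [← sub_eq_zero]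
    exact htf s s.2 _ (by rw [smul_sub, hk', mul_smul, sub_self])

/-- In positive degrees, the weak dimension of `M` is controlled by the total ring of fractions, since
syzygies are torsion-free. -/
lemma weakDimLE_succ_of_localizedModule [PreValuationRing R] {M : Type u} [AddCommGroup M]
    [Module R M] {n : ℕ}
    (h : WeakDimLE (Localization (nonZeroDivisors R)) (LocalizedModule (nonZeroDivisors R) M)
      (n + 1)) : WeakDimLE R M (n + 1) := by
  induction n generalizing M with
  | zero =>
    obtain ⟨K, F, _, _, _, _, i, p, H⟩ := exists_flatPresentation R M
    have := H.flat
    rw [(H.localizedModule (nonZeroDivisors R)).weakDimLE_succ_iff, weakDimLE_zero_iff] at h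
    rw [H.weakDimLE_succ_iff, weakDimLE_zero_iff]
    refine flat_of_flat_localizedModule (fun s hs x hx ↦ H.inj ?_) h
    have := Module.Flat.isSMulRegular_of_nonZeroDivisors (M := F) hs
    refine this ?_
    change s • i x = s • i 0
    rw [← map_smul, hx, map_zero, smul_zero]
  | succ n ih =>
    obtain ⟨K, F, _, _, _, _, i, p, H⟩ := exists_flatPresentation R M
    rw [(H.localizedModule (nonZeroDivisors R)).weakDimLE_succ_iff] at h
    rw [H.weakDimLE_succ_iff]
    exact ih h

lemma weakDimLE_zero_of_isIFRing (hR : IsIFRing R) {M : Type u} [AddCommGroup M] [Module R M]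
    {n : ℕ} (h : WeakDimLE R M n) : WeakDimLE R M 0 :=
  h.of_injective_le fun E _ _ hE ↦ weakDimLE_zero_iff.2 (hR E hE)

variable [PreValuationRing R]

lemma weakDimLE_one_of_isSemicoherentRing (hR : IsSemicoherentRing R) {M : Type u}
    [AddCommGroup M] [Module R M] {n : ℕ} (h : WeakDimLE R M n) : WeakDimLE R M 1 :=
  weakDimLE_succ_of_localizedModule
    (weakDimLE_zero_of_isIFRing (hR.isIFRing _) (h.localizedModule (nonZeroDivisors R))).succ

lemma isLocalRing_localization_nonZeroDivisors [Nontrivial R] :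
    IsLocalRing (Localization (nonZeroDivisors R)) :=
  have := preValuationRing_of_isLocalization (Localization (nonZeroDivisors R)) (nonZeroDivisors R)
  have := (IsFractionRing.injective R (Localization (nonZeroDivisors R))).nontrivial
  ValuationRing.isLocalRing _

lemma weakDimLE_two_of_preValuationRing [Nontrivial R] {M : Type u} [AddCommGroup M] [Module R M]
    {n : ℕ} (h : WeakDimLE R M n) : WeakDimLE R M 2 := by
  let Q := Localization (nonZeroDivisors R)
  have := preValuationRing_of_isLocalization Q (nonZeroDivisors R)
  have := isLocalRing_localization_nonZeroDivisors (R := R)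
  by_cases hIF : IsIFRing Q
  · exact (weakDimLE_one_of_isSemicoherentRing (isSemicoherentRing_of_isIFRing hIF) h).succ
  · exact weakDimLE_succ_of_localizedModule
      ((h.localizedModule (nonZeroDivisors R)).of_injective_le fun E _ _ hE ↦
        weakDimLE_two_of_injective (nonZeroDivisors_le_isUnit_of_isFractionRing (R := R) Q) hIF hE)

/-- If all regular elements are units, `R` is its own total ring of fractions, hence IF when it is
semicoherent; so there is a regular nonunit `a`, and `R ⧸ (a)` is the required module. -/
lemma exists_weakDimLE_one_not_zero (hsc : IsSemicoherentRing R) (hIF : ¬ IsIFRing R) :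
    ∃ (M : Type u) (_ : AddCommGroup M) (_ : Module R M), WeakDimLE R M 1 ∧ ¬ WeakDimLE R M 0 := by
  obtain ⟨a, ha, hau⟩ : ∃ a ∈ nonZeroDivisors R, ¬ IsUnit a := by
    by_contra! h
    have : IsFractionRing R R := IsLocalization.self h
    exact hIF (hsc.isIFRing R)
  let I := Ideal.span {a}
  have H : FlatPresentation (LinearMap.toSpanSingleton R R a) I.mkQ := by
    refine ⟨inferInstance, ?_, ?_, I.mkQ_surjective⟩
    · rw [injective_iff_map_eq_zero]
      exact mem_nonZeroDivisors_iff_right.1 ha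
    · intro x
      rw [Submodule.mkQ_apply, Submodule.Quotient.mk_eq_zero, Ideal.mem_span_singleton']
      rfl
  refine ⟨R ⧸ I, inferInstance, inferInstance,
    H.weakDimLE_succ_iff.2 (weakDimLE_zero_iff.2 inferInstance), fun h ↦ ?_⟩
  have := weakDimLE_zero_iff.1 h
  have hreg := Module.Flat.isSMulRegular_of_nonZeroDivisors (M := R ⧸ I) ha
  have h1 : I.mkQ 1 = 0 := hreg (by
    change a • I.mkQ 1 = a • 0
    rw [smul_zero, ← map_smul, smul_eq_mul, mul_one, Submodule.mkQ_apply,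
      Submodule.Quotient.mk_eq_zero]
    exact Ideal.mem_span_singleton_self a)
  rw [Submodule.mkQ_apply, Submodule.Quotient.mk_eq_zero, Ideal.mem_span_singleton] at h1
  exact hau (isUnit_of_dvd_one h1)

/-- The module is an injective module over the total ring of fractions `Q`, restricted to `R`. -/
lemma exists_weakDimLE_two_not_one [Nontrivial R] (hsc : ¬ IsSemicoherentRing R) :
    ∃ (M : Type u) (_ : AddCommGroup M) (_ : Module R M), WeakDimLE R M 2 ∧ ¬ WeakDimLE R M 1 := by
  let Q := Localization (nonZeroDivisors R)
  have := preValuationRing_of_isLocalization Q (nonZeroDivisors R)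
  have := isLocalRing_localization_nonZeroDivisors (R := R)
  have hQ := nonZeroDivisors_le_isUnit_of_isFractionRing (R := R) Q
  have hIF : ¬ IsIFRing Q := fun h ↦ hsc (isSemicoherentRing_of_isIFRing h)
  obtain ⟨E, _, _, hE, hE1⟩ := exists_injective_not_weakDimLE_one hQ hIF
  obtain ⟨_, h⟩ := exists_weakDimLE_iff_of_isLocalization (nonZeroDivisors R) Q E
  exact ⟨E, inferInstance, inferInstance, (h 2).2 (weakDimLE_two_of_injective hQ hIF hE),
    fun h1 ↦ hE1 ((h 1).1 h1)⟩

end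

/-! ### Arithmetical rings -/

section

variable {R : Type u} [CommRing R]

lemma finitisticWeakDimension_le_of_localization {d : ℕ}
    (h : ∀ (P : Ideal R) [P.IsMaximal] (M : Type u) [AddCommGroup M]
      [Module (Localization.AtPrime P) M] (n : ℕ),
      WeakDimLE (Localization.AtPrime P) M n → WeakDimLE (Localization.AtPrime P) M d) :
    finitisticWeakDimension R ≤ d :=
  finitisticWeakDimension_le_iff.2 fun _ _ _ n hM ↦
    weakDimLE_of_localized_maximal fun P _ ↦ h P _ n (hM.localizedModule P.primeCompl)

lemma succ_le_finitisticWeakDimension_of_localization {d n : ℕ} (P : Ideal R) [P.IsMaximal]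
    (h : ∃ (M : Type u) (_ : AddCommGroup M) (_ : Module (Localization.AtPrime P) M),
      WeakDimLE (Localization.AtPrime P) M n ∧ ¬ WeakDimLE (Localization.AtPrime P) M d) :
    ((d + 1 : ℕ) : ℕ∞) ≤ finitisticWeakDimension R := by
  obtain ⟨M, _, _, hn, hd⟩ := h
  obtain ⟨_, hM⟩ := exists_weakDimLE_iff_of_isLocalization P.primeCompl (Localization.AtPrime P) M
  exact succ_le_finitisticWeakDimension M ((hM n).2 hn) fun h1 ↦ hd ((hM d).1 h1)

end

theorem theorem1 (R : Type u) [CommRing R] (hR : IsArithmeticalRing R) :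
    (IsLocallyIF R → finitisticWeakDimension R = 0) ∧
    (IsLocallySemicoherent R ∧ ¬ IsLocallyIF R → finitisticWeakDimension R = 1) ∧
    (¬ IsLocallySemicoherent R → finitisticWeakDimension R = 2) ∧
    finitisticWeakDimension R ≤ 2 := by
  have hchain : ∀ (P : Ideal R) [P.IsMaximal], PreValuationRing (Localization.AtPrime P) :=
    fun P _ ↦ (hR P).preValuationRing
  have hle : finitisticWeakDimension R ≤ 2 :=
    finitisticWeakDimension_le_of_localization (d := 2) fun P _ M _ _ n h ↦
      have := hchain P
      weakDimLE_two_of_preValuationRing h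
  refine ⟨fun hIF ↦ ?_, fun ⟨hsc, hIF⟩ ↦ ?_, fun hsc ↦ ?_, hle⟩
  · exact nonpos_iff_eq_zero.1 (finitisticWeakDimension_le_of_localization (d := 0)
      fun P _ M _ _ n h ↦ weakDimLE_zero_of_isIFRing (hIF P) h)
  · refine le_antisymm (finitisticWeakDimension_le_of_localization (d := 1)
      fun P _ M _ _ n h ↦ ?_) ?_
    · have := hchain P
      exact weakDimLE_one_of_isSemicoherentRing (hsc P) h
    · simp only [IsLocallyIF, not_forall] at hIF
      obtain ⟨P, _, hP⟩ := hIF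
      have := hchain P
      exact succ_le_finitisticWeakDimension_of_localization (d := 0) P
        (exists_weakDimLE_one_not_zero (hsc P) hP)
  · refine le_antisymm hle ?_
    simp only [IsLocallySemicoherent, not_forall] at hsc
    obtain ⟨P, _, hP⟩ := hsc
    have := hchain P
    exact succ_le_finitisticWeakDimension_of_localization (d := 1) P
      (exists_weakDimLE_two_not_one hP)
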